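/- Let $X,Y,M$ be finite-dimensional Hilbert spaces, let $A,B$ be positive integers and let $0<\epsilon<1$. Logarithms are to base $2$. A subnormalised density matrix is a positive semidefinite matrix of trace at most one; a normalised density matrix has trace exactly one. For a subnormalised density matrix $\omega$ and a positive semidefinite matrix $\theta$ on the same space let \[ D_2(\omega\|\theta) := 2\log\bigl\|\theta^{-1/4}\,\omega\,\theta^{-1/4}\bigr\|_2 \quad\text{if } \mathrm{supp}(\omega)\subseteq\mathrm{supp}(\theta), \qquad D_2(\omega\|\theta):=+\infty \text{ otherwise}, \] where $\theta^{-1/4}$ is taken on the support of $\theta$, $\|\cdot\|_p$ is the Schatten $p$-norm and $\log 0:=-\infty$. Let \[ D_2^\epsilon(\omega\|\theta) := \min\{D_2(\omega'\|\theta) : \omega' \text{ a subnormalised density matrix with } \|\omega'-\omega\|_1\le \epsilon\,\mathrm{Tr}\,\omega\}. \] Let $\rho^{XYM}\neq 0$ be a subnormalised density matrix on $X\otimes Y\otimes M$, with marginals denoted by superscripts, and let $\alpha^X$, $\beta^Y$ be normalised density matrices with $\mathrm{supp}(\rho^X)\subseteq\mathrm{supp}(\alpha^X)$ and $\mathrm{supp}(\rho^Y)\subseteq\mathrm{supp}(\beta^Y)$.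 Define the convex split state and the fully decoupled state on $X^{\otimes A}\otimes Y^{\otimes B}\otimes M$ by \[ \sigma := \frac{1}{AB}\sum_{a=1}^{A}\sum_{b=1}^{B} \rho^{X_aY_bM}\otimes\alpha^{X^{-a}}\otimes\beta^{Y^{-b}}, \qquad \tau := (\alpha^X)^{\otimes A}\otimes(\beta^Y)^{\otimes B}\otimes\rho^M, \] where $\rho^{X_aY_bM}$ acts on the $a$-th copy of $X$, the $b$-th copy of $Y$ and $M$, and $\alpha^{X^{-a}}$, $\beta^{Y^{-b}}$ are the tensor powers of $\alpha^X$, $\beta^Y$ on all the other copies. Suppose that \begin{align*} \log A &> D_2^\epsilon(\rho^{XM}\,\|\,\alpha^X\otimes\rho^M)-\log\mathrm{Tr}\,\rho+\log\epsilon^{-2},\\ \log B &> D_2^\epsilon(\rho^{YM}\,\|\,\beta^Y\otimes\rho^M)-\log\mathrm{Tr}\,\rho+\log\epsilon^{-2},\\ \log A+\log B &> D_2^\epsilon(\rho^{XYM}\,\|\,\alpha^X\otimes\beta^Y\otimes\rho^M)-\log\mathrm{Tr}\,\rho+\log\epsilon^{-2}. \end{align*} (The term $\log\mathrm{Tr}\,\rho$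 vanishes when $\rho$ is normalised; it makes the conditions invariant under rescaling $\rho$.) Then \[ \|\sigma-\tau\|_1 < 16\,\epsilon\,\mathrm{Tr}\,\rho . \] -/

import Mathlib

open scoped Kronecker ComplexOrder

noncomputable section

namespace ConvexSplit

variable {n x y m : Type*} [Fintype n] [DecidableEq n] [Fintype x] [DecidableEq x]
  [Fintype y] [DecidableEq y] [Fintype m] [DecidableEq m]

/-- A subnormalised density matrix: positive semidefinite with trace at most one. -/
def IsSubnormalised (ρ : Matrix n n ℂ) : Prop :=
  ρ.PosSemidef ∧ ρ.trace.re ≤ 1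

/-- A normalised density matrix: positive semidefinite with trace exactly one. -/
def IsDensity (ρ : Matrix n n ℂ) : Prop :=
  ρ.PosSemidef ∧ ρ.trace = 1

/-- The support of a Hermitian matrix, that is, its range. -/
def supp (ρ : Matrix n n ℂ) : Submodule ℂ (n → ℂ) :=
  LinearMap.range ρ.mulVecLin

/-- The Schatten-1 norm `Tr[(Tᴴ T)^{1/2}]`. -/
def traceNorm (T : Matrix n n ℂ) : ℝ :=
  (cfc Real.sqrt (T.conjTranspose * T)).trace.re

/-- The Schatten-2 norm `(Tr[Tᴴ T])^{1/2}`. -/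
def hsNorm (T : Matrix n n ℂ) : ℝ :=
  Real.sqrt (T.conjTranspose * T).trace.re

/-- `β^{-1/4}` for a positive semidefinite `β`, taken on the support of `β` and zero on its
kernel (for real powers in Mathlib, `0 ^ (-1/4) = 0`). -/
def invFourthRoot (β : Matrix n n ℂ) : Matrix n n ℂ :=
  cfc (fun t : ℝ => t ^ (-(1 / 4) : ℝ)) β

open Classical in
/-- The Rényi-2 divergence `D₂(α‖β) = 2 log₂ ‖β^{-1/4} α β^{-1/4}‖₂` if
`supp α ≤ supp β`, and `+∞` otherwise; here `log 0 = -∞`. -/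
def D2 (α β : Matrix n n ℂ) : EReal :=
  if supp α ≤ supp β then
    if hsNorm (invFourthRoot β * α * invFourthRoot β) = 0 then ⊥
    else ((2 * Real.logb 2 (hsNorm (invFourthRoot β * α * invFourthRoot β)) : ℝ) : EReal)
  else ⊤

/-- The `ε`-smooth Rényi-2 divergence: the minimum of `D₂(α'‖β)` over all subnormalised density
matrices `α'` with `‖α' - α‖₁ ≤ ε Tr α`. -/
def smoothD2 (ε : ℝ) (α β : Matrix n n ℂ) : EReal :=
  ⨅ α' ∈ {α' : Matrix n n ℂ | IsSubnormalised α' ∧ traceNorm (α' - α) ≤ ε * α.trace.re},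
    D2 α' β

/-- The marginal on `X ⊗ M` of a matrix on `X ⊗ Y ⊗ M`. -/
def margXM (ρ : Matrix (x × y × m) (x × y × m) ℂ) : Matrix (x × m) (x × m) ℂ :=
  Matrix.of fun i j => ∑ b : y, ρ (i.1, b, i.2) (j.1, b, j.2)

/-- The marginal on `Y ⊗ M` of a matrix on `X ⊗ Y ⊗ M`. -/
def margYM (ρ : Matrix (x × y × m) (x × y × m) ℂ) : Matrix (y × m) (y × m) ℂ :=
  Matrix.of fun i j => ∑ a : x, ρ (a, i.1, i.2) (a, j.1, j.2)

/-- The marginal on `X` of a matrix on `X ⊗ Y ⊗ M`. -/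
def margX (ρ : Matrix (x × y × m) (x × y × m) ℂ) : Matrix x x ℂ :=
  Matrix.of fun i j => ∑ b : y, ∑ c : m, ρ (i, b, c) (j, b, c)

/-- The marginal on `Y` of a matrix on `X ⊗ Y ⊗ M`. -/
def margY (ρ : Matrix (x × y × m) (x × y × m) ℂ) : Matrix y y ℂ :=
  Matrix.of fun i j => ∑ a : x, ∑ c : m, ρ (a, i, c) (a, j, c)

/-- The marginal on `M` of a matrix on `X ⊗ Y ⊗ M`. -/
def margM (ρ : Matrix (x × y × m) (x × y × m) ℂ) : Matrix m m ℂ :=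
  Matrix.of fun i j => ∑ a : x, ∑ b : y, ρ (a, b, i) (a, b, j)

/-- The tensor power `α^{⊗ A}`; the basis of the tensor power of `A` copies of `X` is indexed by
`Fin A → x`. -/
def tensorPow (A : ℕ) (α : Matrix x x ℂ) : Matrix (Fin A → x) (Fin A → x) ℂ :=
  Matrix.of fun s t => ∏ i, α (s i) (t i)

/-- The matrix `ρ^{X_a Y_b M} ⊗ α^{X^{-a}} ⊗ β^{Y^{-b}}`: `ρ` sits on the `a`-th copy of `X`, the
`b`-th copy of `Y` and on `M`, and `α`, `β` sit on all other copies of `X` and `Y`. -/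
def placed {A B : ℕ} (ρ : Matrix (x × y × m) (x × y × m) ℂ) (α : Matrix x x ℂ)
    (β : Matrix y y ℂ) (a : Fin A) (b : Fin B) :
    Matrix ((Fin A → x) × (Fin B → y) × m) ((Fin A → x) × (Fin B → y) × m) ℂ :=
  Matrix.of fun s t =>
    ρ (s.1 a, s.2.1 b, s.2.2) (t.1 a, t.2.1 b, t.2.2)
      * (∏ i ∈ Finset.univ.erase a, α (s.1 i) (t.1 i))
      * (∏ j ∈ Finset.univ.erase b, β (s.2.1 j) (t.2.1 j))

/-- The convex split state `(AB)⁻¹ ∑_a ∑_b ρ^{X_a Y_b M} ⊗ α^{X^{-a}} ⊗ β^{Y^{-b}}`. -/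
def convexSplitState (A B : ℕ) (ρ : Matrix (x × y × m) (x × y × m) ℂ) (α : Matrix x x ℂ)
    (β : Matrix y y ℂ) :
    Matrix ((Fin A → x) × (Fin B → y) × m) ((Fin A → x) × (Fin B → y) × m) ℂ :=
  ((A : ℂ) * (B : ℂ))⁻¹ • ∑ a : Fin A, ∑ b : Fin B, placed ρ α β a b

/-- The fully decoupled state `α^{⊗ A} ⊗ β^{⊗ B} ⊗ ρ^M`. -/
def decoupledState (A B : ℕ) (ρ : Matrix (x × y × m) (x × y × m) ℂ) (α : Matrix x x ℂ)
    (β : Matrix y y ℂ) :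
    Matrix ((Fin A → x) × (Fin B → y) × m) ((Fin A → x) × (Fin B → y) × m) ℂ :=
  tensorPow A α ⊗ₖ (tensorPow B β ⊗ₖ margM ρ)

end ConvexSplit

end

/-!
Replacing one tensor factor at a time, `σ - τ` telescopes into three terms built from the map
"convex split minus decoupling" on a single factor. That map sends `K` to an average over `A` copies
of centred versions of `K`. Weighted by the fourth roots of `α`, centred matrices sitting on
different copies are orthogonal for the Hilbert–Schmidt inner product, so by Pythagoras the map
contracts the weighted Hilbert–Schmidt norm by `1 / √A`; Hölder's inequality turns this into a bound
on the trace norm. Passing from a smoothing of `ρ` back to `ρ` costs trace norm only, as the maps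
have trace-norm bounds `2`, `2` and `4`. The three terms contribute `3`, `3` and `5` multiples of
`ε Tr ρ`, in total `11 < 16`.
-/

open Matrix
open scoped MatrixOrder

namespace ConvexSplit

section TraceNorm

variable {n : Type*} [Fintype n]

theorem trace_mul_re_nonneg {P Q : Matrix n n ℂ} (hP : P.PosSemidef) (hQ : Q.PosSemidef) :
    0 ≤ (P * Q).trace.re := by
  classical
  obtain ⟨C, rfl⟩ := CStarAlgebra.nonneg_iff_eq_star_mul_self.mp hP.nonneg
  rw [star_eq_conjTranspose, Matrix.mul_assoc, trace_mul_comm]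
  exact (Complex.nonneg_iff.mp (hQ.mul_mul_conjTranspose_same C).trace_nonneg).1

variable [DecidableEq n]

theorem continuousOn_spectrum (T : Matrix n n ℂ) (f : ℝ → ℝ) : ContinuousOn f (spectrum ℝ T) :=
  T.finite_real_spectrum.continuousOn f

theorem isHermitian_cfc (f : ℝ → ℝ) (T : Matrix n n ℂ) : (cfc f T).IsHermitian :=
  (cfc_predicate f T : IsSelfAdjoint _)

theorem posSemidef_cfc {f : ℝ → ℝ} (hf : ∀ t, 0 ≤ f t) (T : Matrix n n ℂ) :
    (cfc f T).PosSemidef :=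
  nonneg_iff_posSemidef.mp (cfc_nonneg fun t _ => hf t)

theorem cfc_mul_cfc (f g : ℝ → ℝ) (T : Matrix n n ℂ) :
    cfc f T * cfc g T = cfc (fun t => f t * g t) T :=
  (cfc_mul f g T (continuousOn_spectrum T f) (continuousOn_spectrum T g)).symm

theorem traceNorm_eq_trace_abs (T : Matrix n n ℂ) : traceNorm T = (CFC.abs T).trace.re := by
  rw [traceNorm, CFC.abs, CFC.sqrt_eq_real_sqrt _ (star_mul_self_nonneg T), cfcₙ_eq_cfc,
    star_eq_conjTranspose]

theorem exists_posSemidef_sub {T : Matrix n n ℂ} (hT : T.IsHermitian) :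
    ∃ P Q : Matrix n n ℂ, P.PosSemidef ∧ Q.PosSemidef ∧ T = P - Q ∧
      traceNorm T = P.trace.re + Q.trace.re := by
  have hT' : IsSelfAdjoint T := hT
  refine ⟨T⁺, T⁻, nonneg_iff_posSemidef.mp (CFC.posPart_nonneg T),
    nonneg_iff_posSemidef.mp (CFC.negPart_nonneg T), (CFC.posPart_sub_negPart T).symm, ?_⟩
  rw [traceNorm_eq_trace_abs, ← CFC.posPart_add_negPart T, trace_add, Complex.add_re]

theorem exists_sign {T : Matrix n n ℂ} (hT : T.IsHermitian) :
    ∃ S : Matrix n n ℂ, S.IsHermitian ∧ S * S = 1 ∧ traceNorm T = (S * T).trace.re := by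
  have hT' : IsSelfAdjoint T := hT
  let sign : ℝ → ℝ := fun t => if t < 0 then -1 else 1
  have sign_mul_sign (t : ℝ) : sign t * sign t = 1 := by
    simp only [sign]; split_ifs <;> norm_num
  have sign_mul (t : ℝ) : sign t * t = ‖t‖ := by
    simp only [sign, Real.norm_eq_abs]
    split_ifs with ht
    · rw [abs_of_neg ht, neg_one_mul]
    · rw [abs_of_nonneg (not_lt.mp ht), one_mul]
  refine ⟨cfc sign T, isHermitian_cfc _ T, ?_, ?_⟩
  · simpa only [cfc_mul_cfc, sign_mul_sign] using cfc_const_one ℝ T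
  · have h := cfc_mul_cfc sign (fun t => t) T
    rw [cfc_id' ℝ T] at h
    rw [traceNorm_eq_trace_abs, CFC.abs_eq_cfc_norm T, h]
    simp only [sign_mul]

theorem posSemidef_one_sub {S : Matrix n n ℂ} (hS : S.IsHermitian) (hSS : S * S = 1) :
    (1 - S).PosSemidef := by
  have h : (1 - S)ᴴ * (1 - S) = (2 : ℝ) • (1 - S) := by
    simp only [conjTranspose_sub, hS.eq, conjTranspose_one, Matrix.mul_sub, Matrix.sub_mul, hSS,
      Matrix.mul_one, Matrix.one_mul]
    module
  have half_smul : 1 - S = (1 / 2 : ℝ) • ((1 - S)ᴴ * (1 - S)) := by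
    rw [h, smul_smul, one_div_mul_cancel two_ne_zero, one_smul]
  rw [half_smul]
  exact (posSemidef_conjTranspose_mul_self _).smul (by norm_num)

theorem traceNorm_sub_le_trace_add_trace {P Q : Matrix n n ℂ} (hP : P.PosSemidef)
    (hQ : Q.PosSemidef) : traceNorm (P - Q) ≤ P.trace.re + Q.trace.re := by
  obtain ⟨S, hS, hSS, hnorm⟩ := exists_sign (hP.1.sub hQ.1)
  have add_posSemidef : (1 + S).PosSemidef := by
    simpa only [sub_neg_eq_add] using posSemidef_one_sub hS.neg (by rw [neg_mul_neg, hSS])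
  have hSP := trace_mul_re_nonneg (posSemidef_one_sub hS hSS) hP
  have hSQ := trace_mul_re_nonneg add_posSemidef hQ
  simp only [Matrix.sub_mul, Matrix.add_mul, Matrix.one_mul, Matrix.mul_sub, trace_sub, trace_add,
    Complex.sub_re, Complex.add_re] at hSP hSQ hnorm
  linarith

theorem traceNorm_add_le {S T : Matrix n n ℂ} (hS : S.IsHermitian) (hT : T.IsHermitian) :
    traceNorm (S + T) ≤ traceNorm S + traceNorm T := by
  obtain ⟨P, Q, hP, hQ, rfl, hPQ⟩ := exists_posSemidef_sub hS
  obtain ⟨P', Q', hP', hQ', rfl, hPQ'⟩ := exists_posSemidef_sub hT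
  have h := traceNorm_sub_le_trace_add_trace (hP.add hP') (hQ.add hQ')
  rw [add_sub_add_comm, trace_add, trace_add, Complex.add_re, Complex.add_re] at h
  linarith

theorem traceNorm_neg (T : Matrix n n ℂ) : traceNorm (-T) = traceNorm T := by
  rw [traceNorm_eq_trace_abs, traceNorm_eq_trace_abs, CFC.abs_neg]

end TraceNorm

section TraceNormBound

variable {n k l : Type*} [Fintype n] [Fintype k] [Fintype l]

/-- A linear map that preserves positive semidefiniteness and the trace. -/
structure IsPosTracePreserving (F : Matrix n n ℂ →ₗ[ℂ] Matrix k k ℂ) : Prop where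
  posSemidef : ∀ {P : Matrix n n ℂ}, P.PosSemidef → (F P).PosSemidef
  trace : ∀ T : Matrix n n ℂ, (F T).trace = T.trace

theorem IsPosTracePreserving.comp {F : Matrix k k ℂ →ₗ[ℂ] Matrix l l ℂ}
    {G : Matrix n n ℂ →ₗ[ℂ] Matrix k k ℂ} (hF : IsPosTracePreserving F)
    (hG : IsPosTracePreserving G) : IsPosTracePreserving (F ∘ₗ G) where
  posSemidef hP := hF.posSemidef (hG.posSemidef hP)
  trace T := (hF.trace _).trans (hG.trace T)

variable [DecidableEq n] [DecidableEq k] [DecidableEq l]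

/-- `F` preserves Hermitian matrices and scales their trace norm by at most `c`. It bounds the
effect of `F` on the error made by smoothing a state, which is Hermitian. -/
structure HasTraceNormBound (F : Matrix n n ℂ →ₗ[ℂ] Matrix k k ℂ) (c : ℝ) : Prop where
  isHermitian : ∀ {T : Matrix n n ℂ}, T.IsHermitian → (F T).IsHermitian
  traceNorm_le : ∀ {T : Matrix n n ℂ}, T.IsHermitian → traceNorm (F T) ≤ c * traceNorm T

theorem IsPosTracePreserving.hasTraceNormBound {F : Matrix n n ℂ →ₗ[ℂ] Matrix k k ℂ}
    (hF : IsPosTracePreserving F) : HasTraceNormBound F 1 where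
  isHermitian hT := by
    obtain ⟨P, Q, hP, hQ, rfl, -⟩ := exists_posSemidef_sub hT
    rw [map_sub]
    exact (hF.posSemidef hP).1.sub (hF.posSemidef hQ).1
  traceNorm_le hT := by
    obtain ⟨P, Q, hP, hQ, rfl, hnorm⟩ := exists_posSemidef_sub hT
    rw [one_mul, hnorm, map_sub, ← hF.trace P, ← hF.trace Q]
    exact traceNorm_sub_le_trace_add_trace (hF.posSemidef hP) (hF.posSemidef hQ)

theorem HasTraceNormBound.sub {F G : Matrix n n ℂ →ₗ[ℂ] Matrix k k ℂ} {c d : ℝ}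
    (hF : HasTraceNormBound F c) (hG : HasTraceNormBound G d) :
    HasTraceNormBound (F - G) (c + d) where
  isHermitian hT := (hF.isHermitian hT).sub (hG.isHermitian hT)
  traceNorm_le {T} hT := by
    have h := traceNorm_add_le (hF.isHermitian hT) (hG.isHermitian hT).neg
    rw [traceNorm_neg, ← sub_eq_add_neg] at h
    rw [LinearMap.sub_apply, add_mul]
    exact h.trans (add_le_add (hF.traceNorm_le hT) (hG.traceNorm_le hT))

theorem HasTraceNormBound.comp {F : Matrix k k ℂ →ₗ[ℂ] Matrix l l ℂ}
    {G : Matrix n n ℂ →ₗ[ℂ] Matrix k k ℂ} {c d : ℝ} (hF : HasTraceNormBound F c)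
    (hG : HasTraceNormBound G d) (hc : 0 ≤ c) : HasTraceNormBound (F ∘ₗ G) (c * d) where
  isHermitian hT := hF.isHermitian (hG.isHermitian hT)
  traceNorm_le {T} hT := by
    rw [mul_assoc]
    exact (hF.traceNorm_le (hG.isHermitian hT)).trans
      (mul_le_mul_of_nonneg_left (hG.traceNorm_le hT) hc)

end TraceNormBound

section HilbertSchmidt

variable {n k : Type*} [Fintype n] [Fintype k]

theorem trace_conjTranspose_mul (S T : Matrix n n ℂ) :
    (Sᴴ * T).trace = ∑ i, ∑ j, star (S i j) * T i j := by
  simp only [Matrix.trace, diag, mul_apply, conjTranspose_apply]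
  exact Finset.sum_comm

theorem hsNorm_nonneg (T : Matrix n n ℂ) : 0 ≤ hsNorm T := Real.sqrt_nonneg _

theorem trace_conjTranspose_mul_self (T : Matrix n n ℂ) :
    (Tᴴ * T).trace = ((hsNorm T ^ 2 : ℝ) : ℂ) := by
  have h := (posSemidef_conjTranspose_mul_self T).trace_nonneg
  rw [hsNorm, Real.sq_sqrt (Complex.nonneg_iff.mp h).1]
  exact Complex.eq_re_of_ofReal_le h

theorem hsNorm_eq_of_trace_eq {S : Matrix n n ℂ} {T : Matrix k k ℂ}
    (h : (Sᴴ * S).trace = (Tᴴ * T).trace) : hsNorm S = hsNorm T := by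
  rw [hsNorm, hsNorm, h]

theorem hsNorm_smul (c : ℝ) (T : Matrix n n ℂ) : hsNorm ((c : ℂ) • T) = |c| * hsNorm T := by
  rw [hsNorm, hsNorm, conjTranspose_smul, smul_mul_smul_comm, trace_smul, smul_eq_mul,
    Complex.star_def, Complex.conj_ofReal, ← Complex.ofReal_mul, Complex.re_ofReal_mul,
    Real.sqrt_mul (mul_self_nonneg c), Real.sqrt_mul_self_eq_abs]

theorem hsNorm_kronecker (S : Matrix n n ℂ) (T : Matrix k k ℂ) :
    hsNorm (S ⊗ₖ T) = hsNorm S * hsNorm T := by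
  refine (sq_eq_sq₀ (hsNorm_nonneg _)
    (mul_nonneg (hsNorm_nonneg S) (hsNorm_nonneg T))).mp (Complex.ofReal_injective ?_)
  rw [mul_pow, Complex.ofReal_mul]
  simp only [← trace_conjTranspose_mul_self, conjTranspose_kronecker, ← mul_kronecker_mul,
    trace_kronecker]

theorem trace_conjTranspose_mul_re_le (S T : Matrix n n ℂ) :
    (Sᴴ * T).trace.re ≤ hsNorm S * hsNorm T := by
  have hsNorm_eq (U : Matrix n n ℂ) : hsNorm U = √(∑ p : n × n, ‖U p.1 p.2‖ ^ 2) := by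
    rw [hsNorm, trace_conjTranspose_mul, ← Finset.univ_product_univ, Finset.sum_product]
    simp only [Complex.re_sum, Complex.star_def, Complex.conj_mul', ← Complex.ofReal_pow,
      Complex.ofReal_re]
  calc (Sᴴ * T).trace.re = ∑ p : n × n, (star (S p.1 p.2) * T p.1 p.2).re := by
        rw [trace_conjTranspose_mul, ← Finset.sum_product', Complex.re_sum,
          Finset.univ_product_univ]
    _ ≤ ∑ p : n × n, ‖S p.1 p.2‖ * ‖T p.1 p.2‖ := Finset.sum_le_sum fun p _ =>
        (Complex.re_le_norm _).trans_eq (by rw [norm_mul, norm_star])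
    _ ≤ hsNorm S * hsNorm T := by
        rw [hsNorm_eq S, hsNorm_eq T]
        exact Real.sum_mul_le_sqrt_mul_sqrt _ _ _

variable [DecidableEq n]

/-- Hölder's inequality, with `‖G‖₄²` written as `‖G²‖₂`. -/
theorem traceNorm_mul_mul_le {G K : Matrix n n ℂ} (hG : G.IsHermitian)
    (hGKG : (G * K * G).IsHermitian) : traceNorm (G * K * G) ≤ hsNorm (G ^ 2) * hsNorm K := by
  obtain ⟨S, hS, hSS, hnorm⟩ := exists_sign hGKG
  have hsNorm_unitary_mul : hsNorm (S * G ^ 2) = hsNorm (G ^ 2) :=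
    hsNorm_eq_of_trace_eq (by
      rw [conjTranspose_mul, hS.eq, Matrix.mul_assoc, ← Matrix.mul_assoc S, hSS, Matrix.one_mul])
  have hsNorm_mul_unitary : hsNorm (G ^ 2 * S) = hsNorm (G ^ 2) :=
    hsNorm_eq_of_trace_eq (by
      rw [conjTranspose_mul, hS.eq, trace_mul_comm, Matrix.mul_assoc, ← Matrix.mul_assoc S, hSS,
        Matrix.one_mul, trace_mul_comm])
  have hsNorm_conj_le : hsNorm (G * S * G) ≤ hsNorm (G ^ 2) := by
    refine (sq_le_sq₀ (hsNorm_nonneg _) (hsNorm_nonneg _)).mp ?_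
    calc hsNorm (G * S * G) ^ 2 = ((G ^ 2 * S)ᴴ * (S * G ^ 2)).trace.re := by
          rw [← Complex.ofReal_re (hsNorm _ ^ 2), ← trace_conjTranspose_mul_self]
          simp only [conjTranspose_mul, hG.eq, hS.eq, pow_two, Matrix.mul_assoc]
          rw [trace_mul_comm]
          simp only [Matrix.mul_assoc]
      _ ≤ hsNorm (G ^ 2 * S) * hsNorm (S * G ^ 2) := trace_conjTranspose_mul_re_le _ _
      _ = hsNorm (G ^ 2) ^ 2 := by rw [hsNorm_mul_unitary, hsNorm_unitary_mul, ← sq]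
  calc traceNorm (G * K * G) = ((G * S * G)ᴴ * K).trace.re := by
        rw [hnorm, ← Matrix.mul_assoc, trace_mul_comm]
        simp only [conjTranspose_mul, hG.eq, hS.eq, Matrix.mul_assoc]
    _ ≤ hsNorm (G * S * G) * hsNorm K := trace_conjTranspose_mul_re_le _ _
    _ ≤ hsNorm (G ^ 2) * hsNorm K := mul_le_mul_of_nonneg_right hsNorm_conj_le (hsNorm_nonneg K)

end HilbertSchmidt

section FourthRoot

variable {n k : Type*} [Fintype n] [DecidableEq n] [Fintype k] [DecidableEq k]

/-- The fourth root of a positive semidefinite matrix, the companion of `invFourthRoot`. -/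
noncomputable def fourthRoot (P : Matrix n n ℂ) : Matrix n n ℂ :=
  cfc (fun t : ℝ => t ^ (1 / 4 : ℝ)) P

theorem cfc_congr_of_posSemidef {P : Matrix n n ℂ} (hP : P.PosSemidef) {f g : ℝ → ℝ}
    (h : ∀ t, 0 ≤ t → f t = g t) : cfc f P = cfc g P :=
  cfc_congr fun t ht => h t (spectrum_nonneg_of_nonneg hP.nonneg ht)

theorem isHermitian_fourthRoot (P : Matrix n n ℂ) : (fourthRoot P).IsHermitian :=
  isHermitian_cfc _ P

theorem posSemidef_fourthRoot {P : Matrix n n ℂ} (hP : P.PosSemidef) :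
    (fourthRoot P).PosSemidef := by
  rw [fourthRoot, cfc_congr_of_posSemidef hP (g := fun t => |t| ^ (1 / 4 : ℝ))
    fun t ht => by rw [abs_of_nonneg ht]]
  exact posSemidef_cfc (fun t => Real.rpow_nonneg (abs_nonneg t) _) P

theorem fourthRoot_pow_four {P : Matrix n n ℂ} (hP : P.PosSemidef) : fourthRoot P ^ 4 = P := by
  rw [fourthRoot, ← cfc_pow _ 4 P (continuousOn_spectrum P _) hP.1.isSelfAdjoint,
    cfc_congr_of_posSemidef hP (g := fun t => t), cfc_id' ℝ P hP.1.isSelfAdjoint]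
  intro t ht
  rw [← Real.rpow_natCast, ← Real.rpow_mul ht]
  norm_num

theorem fourthRoot_of_pow_four {Q : Matrix n n ℂ} (hQ : Q.PosSemidef) :
    fourthRoot (Q ^ 4) = Q := by
  rw [fourthRoot, ← cfc_comp_pow (fun t : ℝ => t ^ (1 / 4 : ℝ)) 4 Q
      ((Q.finite_real_spectrum.image _).continuousOn _) hQ.1.isSelfAdjoint,
    cfc_congr_of_posSemidef hQ (g := fun t => t), cfc_id' ℝ Q hQ.1.isSelfAdjoint]
  intro t ht
  rw [← Real.rpow_natCast, ← Real.rpow_mul ht]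
  norm_num

theorem kronecker_pow (P : Matrix n n ℂ) (Q : Matrix k k ℂ) (N : ℕ) :
    (P ⊗ₖ Q) ^ N = (P ^ N) ⊗ₖ (Q ^ N) := by
  induction N with
  | zero => simp only [pow_zero, one_kronecker_one]
  | succ N ih => rw [pow_succ, pow_succ, pow_succ, ih, mul_kronecker_mul]

theorem fourthRoot_kronecker {P : Matrix n n ℂ} {Q : Matrix k k ℂ} (hP : P.PosSemidef)
    (hQ : Q.PosSemidef) : fourthRoot (P ⊗ₖ Q) = fourthRoot P ⊗ₖ fourthRoot Q := by
  conv_lhs => rw [← fourthRoot_pow_four hP, ← fourthRoot_pow_four hQ, ← kronecker_pow]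
  exact fourthRoot_of_pow_four ((posSemidef_fourthRoot hP).kronecker (posSemidef_fourthRoot hQ))

theorem hsNorm_fourthRoot_sq {P : Matrix n n ℂ} (hP : P.PosSemidef) :
    hsNorm (fourthRoot P ^ 2) = √P.trace.re := by
  rw [hsNorm, conjTranspose_pow, (isHermitian_fourthRoot P).eq, ← pow_add,
    fourthRoot_pow_four hP]

theorem hsNorm_fourthRoot_sq_of_isDensity {α : Matrix n n ℂ} (hα : IsDensity α) :
    hsNorm (fourthRoot α ^ 2) = 1 := by
  rw [hsNorm_fourthRoot_sq hα.1, hα.2, Complex.one_re, Real.sqrt_one]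

end FourthRoot

section Smoothing

variable {n k : Type*} [Fintype n] [Fintype k] [DecidableEq k]

theorem exists_eq_mul_of_supp_le {ω θ : Matrix n n ℂ} (h : supp ω ≤ supp θ) :
    ∃ Z : Matrix n n ℂ, ω = θ * Z := by
  classical
  have col_mem (j : n) : ∃ z : n → ℂ, θ *ᵥ z = ω.col j := by
    obtain ⟨z, hz⟩ := h (⟨Pi.single j 1, by simp⟩ : ω.col j ∈ supp ω)
    exact ⟨z, by simpa using hz⟩
  choose z hz using col_mem
  refine ⟨(Matrix.of z)ᵀ, ?_⟩
  ext i j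
  exact (congrFun (hz j) i).symm

variable [DecidableEq n]

theorem fourthRoot_mul_invFourthRoot_mul {θ : Matrix n n ℂ} (hθ : θ.PosSemidef) :
    fourthRoot θ * invFourthRoot θ * θ = θ := by
  have h := cfc_mul_cfc (fun t : ℝ => t ^ (1 / 4 : ℝ) * t ^ (-(1 / 4) : ℝ)) (fun t => t) θ
  rw [← cfc_mul_cfc, cfc_id' ℝ θ hθ.1.isSelfAdjoint] at h
  rw [fourthRoot, invFourthRoot, h, cfc_congr_of_posSemidef hθ (g := fun t => t),
    cfc_id' ℝ θ hθ.1.isSelfAdjoint]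
  intro t ht
  rcases ht.eq_or_lt with rfl | ht
  · rw [mul_zero]
  · rw [← Real.rpow_add ht, add_neg_cancel, Real.rpow_zero, one_mul]

theorem fourthRoot_mul_conj_invFourthRoot_mul {ω θ : Matrix n n ℂ} (hω : ω.IsHermitian)
    (hθ : θ.PosSemidef) (h : supp ω ≤ supp θ) :
    fourthRoot θ * (invFourthRoot θ * ω * invFourthRoot θ) * fourthRoot θ = ω := by
  obtain ⟨Z, hZ⟩ := exists_eq_mul_of_supp_le h
  have left_inv : fourthRoot θ * invFourthRoot θ * ω = ω := by
    rw [hZ, ← Matrix.mul_assoc, fourthRoot_mul_invFourthRoot_mul hθ]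
  have right_inv : ω * (invFourthRoot θ * fourthRoot θ) = ω := by
    have adjoint := congrArg conjTranspose left_inv
    rwa [conjTranspose_mul, conjTranspose_mul, hω.eq, (isHermitian_fourthRoot θ).eq,
      show (invFourthRoot θ)ᴴ = invFourthRoot θ from isHermitian_cfc _ θ] at adjoint
  calc fourthRoot θ * (invFourthRoot θ * ω * invFourthRoot θ) * fourthRoot θ
      = fourthRoot θ * invFourthRoot θ * ω * (invFourthRoot θ * fourthRoot θ) := by
        simp only [Matrix.mul_assoc]
    _ = ω := by rw [left_inv, right_inv]

theorem exists_eq_conj_fourthRoot_of_D2_lt {ω θ : Matrix n n ℂ} (hω : ω.IsHermitian)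
    (hθ : θ.PosSemidef) {r : ℝ} (h : D2 ω θ < ((2 * Real.logb 2 r : ℝ) : EReal)) (hr : 0 < r) :
    ∃ K : Matrix n n ℂ, fourthRoot θ * K * fourthRoot θ = ω ∧ hsNorm K < r := by
  by_cases hsupp : supp ω ≤ supp θ
  · refine ⟨invFourthRoot θ * ω * invFourthRoot θ,
      fourthRoot_mul_conj_invFourthRoot_mul hω hθ hsupp, ?_⟩
    rw [D2, if_pos hsupp] at h
    split_ifs at h with hzero
    · rwa [hzero]
    · rw [EReal.coe_lt_coe_iff, mul_lt_mul_iff_right₀ two_pos] at h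
      exact (Real.logb_lt_logb_iff one_lt_two ((hsNorm_nonneg _).lt_of_ne' hzero) hr).mp h
  · rw [D2, if_neg hsupp] at h
    exact absurd h not_top_lt

theorem exists_conj_fourthRoot_near_of_smoothD2_lt {ε : ℝ} (hε : 0 < ε) {ω θ : Matrix n n ℂ}
    (hθ : θ.PosSemidef) {N t : ℝ} (hN : 0 < N) (ht : 0 < t)
    (h : smoothD2 ε ω θ - ((Real.logb 2 t : ℝ) : EReal)
      + ((Real.logb 2 (ε ^ (-2 : ℤ)) : ℝ) : EReal) < ((Real.logb 2 N : ℝ) : EReal)) :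
    ∃ K : Matrix n n ℂ, (fourthRoot θ * K * fourthRoot θ).IsHermitian ∧
      traceNorm (fourthRoot θ * K * fourthRoot θ - ω) ≤ ε * ω.trace.re ∧
      hsNorm K < ε * √(N * t) := by
  have log_bound : 2 * Real.logb 2 (ε * √(N * t)) =
      Real.logb 2 N - Real.logb 2 (ε ^ (-2 : ℤ)) + Real.logb 2 t := by
    rw [Real.logb_mul hε.ne' (by positivity), Real.sqrt_eq_rpow,
      Real.logb_rpow_eq_mul_logb_of_pos (by positivity), Real.logb_mul hN.ne' ht.ne',
      ← Real.rpow_intCast, Real.logb_rpow_eq_mul_logb_of_pos hε]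
    push_cast
    ring
  have smoothD2_lt : smoothD2 ε ω θ < ((2 * Real.logb 2 (ε * √(N * t)) : ℝ) : EReal) := by
    rw [log_bound, EReal.coe_add, EReal.coe_sub]
    have sub_lt :=
      (EReal.lt_sub_iff_add_lt (.inl (EReal.coe_ne_bot _)) (.inl (EReal.coe_ne_top _))).mpr h
    exact (EReal.sub_lt_iff (.inl (EReal.coe_ne_bot _)) (.inl (EReal.coe_ne_top _))).mp sub_lt
  simp only [smoothD2, iInf_lt_iff] at smoothD2_lt
  obtain ⟨ω', ⟨hω', hdist⟩, hD2⟩ := smoothD2_lt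
  obtain ⟨K, rfl, hK⟩ := exists_eq_conj_fourthRoot_of_D2_lt hω'.1.1 hθ hD2 (by positivity)
  exact ⟨K, hω'.1.1, hdist, hK⟩

/-- The weighted Hilbert–Schmidt bound is applied to a smoothing of `ω`; only the trace norm of `F`
enters on the way back to `ω`. -/
theorem HasTraceNormBound.traceNorm_le_of_smoothD2_lt {F : Matrix n n ℂ →ₗ[ℂ] Matrix k k ℂ}
    {c : ℝ} (hF : HasTraceNormBound F c) (hc : 0 ≤ c) {ε : ℝ} (hε : 0 < ε) {ω θ : Matrix n n ℂ}
    (hω : ω.IsHermitian) (hθ : θ.PosSemidef) {N t : ℝ} (hN : 0 < N) (ht : 0 < t)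
    (htrace : ω.trace.re = t)
    (hweighted : ∀ K : Matrix n n ℂ, (fourthRoot θ * K * fourthRoot θ).IsHermitian →
      traceNorm (F (fourthRoot θ * K * fourthRoot θ)) ≤ √t * (hsNorm K / √N))
    (h : smoothD2 ε ω θ - ((Real.logb 2 t : ℝ) : EReal)
      + ((Real.logb 2 (ε ^ (-2 : ℤ)) : ℝ) : EReal) < ((Real.logb 2 N : ℝ) : EReal)) :
    traceNorm (F ω) ≤ (1 + c) * (ε * t) := by
  obtain ⟨K, hK, hdist, hnorm⟩ := exists_conj_fourthRoot_near_of_smoothD2_lt hε hθ hN ht h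
  set ω' := fourthRoot θ * K * fourthRoot θ
  have near : traceNorm (F ω') ≤ ε * t := by
    calc traceNorm (F ω') ≤ √t * (hsNorm K / √N) := hweighted K hK
      _ ≤ √t * (ε * √(N * t) / √N) := by gcongr
      _ = ε * t := by
        rw [Real.sqrt_mul hN.le]
        field_simp
        rw [Real.sq_sqrt ht.le]
  have error : traceNorm (F (ω' - ω)) ≤ c * (ε * t) := by
    rw [htrace] at hdist
    exact (hF.traceNorm_le (hK.sub hω)).trans (mul_le_mul_of_nonneg_left hdist hc)
  calc traceNorm (F ω) = traceNorm (F ω' + -F (ω' - ω)) := by rw [map_sub]; congr 1; abel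
    _ ≤ traceNorm (F ω') + traceNorm (-F (ω' - ω)) :=
        traceNorm_add_le (hF.isHermitian hK) (hF.isHermitian (hK.sub hω)).neg
    _ ≤ ε * t + c * (ε * t) := by rw [traceNorm_neg]; exact add_le_add near error
    _ = (1 + c) * (ε * t) := by ring

end Smoothing

section PartialInner

variable {x r : Type*}

@[elab_as_elim]
theorem kronecker_induction [Finite x] [Finite r] {p : Matrix (x × r) (x × r) ℂ → Prop}
    (K : Matrix (x × r) (x × r) ℂ) (add : ∀ K L, p K → p L → p (K + L))
    (kronecker : ∀ (k : Matrix x x ℂ) (l : Matrix r r ℂ), p (k ⊗ₖ l)) : p K := by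
  classical
  refine Matrix.induction_on' K ?_ add fun i j z => ?_
  · simpa only [zero_kronecker] using kronecker 0 0
  · simpa only [single_kronecker_single, mul_one] using
      kronecker (single i.1 j.1 z) (single i.2 j.2 1)

variable [Fintype x]

/-- The partial inner product `Tr_X[(tᴴ ⊗ 1) K]` with a matrix `t` on the first factor. For
`t = 1` it is the partial trace over `X`. -/
def partialInner (t : Matrix x x ℂ) : Matrix (x × r) (x × r) ℂ →ₗ[ℂ] Matrix r r ℂ where
  toFun K := of fun i j => ∑ p, ∑ q, star (t p q) * K (p, i) (q, j)
  map_add' K L := by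
    ext i j
    simp only [of_apply, Matrix.add_apply, mul_add, Finset.sum_add_distrib]
  map_smul' c K := by
    ext i j
    simp only [of_apply, Matrix.smul_apply, smul_eq_mul, RingHom.id_apply, Finset.mul_sum,
      mul_left_comm]

theorem partialInner_apply (t : Matrix x x ℂ) (K : Matrix (x × r) (x × r) ℂ) (i j : r) :
    partialInner t K i j = ∑ p, ∑ q, star (t p q) * K (p, i) (q, j) :=
  rfl

theorem partialInner_one_apply [DecidableEq x] (K : Matrix (x × r) (x × r) ℂ) (i j : r) :
    partialInner 1 K i j = ∑ p, K (p, i) (p, j) := by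
  refine Finset.sum_congr rfl fun p _ => ?_
  rw [Finset.sum_eq_single_of_mem p (Finset.mem_univ p) fun q _ hq => by
    rw [one_apply_ne' hq, star_zero, zero_mul], one_apply_eq, star_one, one_mul]

theorem partialInner_kronecker (t k : Matrix x x ℂ) (l : Matrix r r ℂ) :
    partialInner t (k ⊗ₖ l) = (tᴴ * k).trace • l := by
  ext i j
  rw [partialInner_apply, Matrix.smul_apply, smul_eq_mul, trace_conjTranspose_mul]
  simp only [kronecker_apply, Finset.sum_mul, mul_assoc]

theorem trace_conjTranspose_mul_self_of_hsNorm_eq_one {u : Matrix x x ℂ} (hu : hsNorm u = 1) :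
    (uᴴ * u).trace = 1 := by
  rw [trace_conjTranspose_mul_self, hu, one_pow, Complex.ofReal_one]

theorem partialInner_sub_kronecker_self {u : Matrix x x ℂ} (hu : hsNorm u = 1)
    (K : Matrix (x × r) (x × r) ℂ) :
    partialInner u (K - u ⊗ₖ partialInner u K) = 0 := by
  rw [map_sub, partialInner_kronecker, trace_conjTranspose_mul_self_of_hsNorm_eq_one hu, one_smul,
    sub_self]

variable [Fintype r]

theorem partialInner_conj (t g : Matrix x x ℂ) (h : Matrix r r ℂ)
    (K : Matrix (x × r) (x × r) ℂ) :
    partialInner t ((g ⊗ₖ h) * K * (g ⊗ₖ h)) = h * partialInner (gᴴ * t * gᴴ) K * h := by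
  induction K using kronecker_induction with
  | add K L hK hL => simp only [Matrix.mul_add, Matrix.add_mul, map_add, hK, hL]
  | kronecker k l =>
    have trace_eq : (tᴴ * (g * k * g)).trace = ((gᴴ * t * gᴴ)ᴴ * k).trace := by
      simp only [conjTranspose_mul, conjTranspose_conjTranspose]
      rw [← Matrix.mul_assoc, trace_mul_comm]
      simp only [Matrix.mul_assoc]
    rw [← mul_kronecker_mul, ← mul_kronecker_mul, partialInner_kronecker, partialInner_kronecker,
      trace_eq, Matrix.mul_smul, Matrix.smul_mul]

theorem trace_kronecker_conjTranspose_mul (t : Matrix x x ℂ) (L : Matrix r r ℂ)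
    (K : Matrix (x × r) (x × r) ℂ) :
    ((t ⊗ₖ L)ᴴ * K).trace = (Lᴴ * partialInner t K).trace := by
  induction K using kronecker_induction with
  | add K L hK hL => simp only [Matrix.mul_add, map_add, trace_add, hK, hL]
  | kronecker k l =>
    rw [conjTranspose_kronecker, ← mul_kronecker_mul, trace_kronecker, partialInner_kronecker,
      Matrix.mul_smul, trace_smul, smul_eq_mul]

theorem isPosTracePreserving_partialInner_one [DecidableEq x] :
    IsPosTracePreserving (partialInner (r := r) (1 : Matrix x x ℂ)) where
  posSemidef {P} hP := by
    have h : partialInner 1 P = ∑ p : x, P.submatrix (Prod.mk p) (Prod.mk p) := by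
      ext i j
      rw [partialInner_one_apply, Matrix.sum_apply]
      rfl
    rw [h]
    exact posSemidef_sum _ fun p _ => hP.submatrix _
  trace T := by
    simp only [Matrix.trace, diag, partialInner_one_apply, Fintype.sum_prod_type]
    exact Finset.sum_comm

theorem hsNorm_sub_kronecker_partialInner_le {u : Matrix x x ℂ} (hu : hsNorm u = 1)
    (K : Matrix (x × r) (x × r) ℂ) : hsNorm (K - u ⊗ₖ partialInner u K) ≤ hsNorm K := by
  set C := K - u ⊗ₖ partialInner u K with hC
  have orthogonal : ((u ⊗ₖ partialInner u K)ᴴ * C).trace = 0 := by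
    rw [trace_kronecker_conjTranspose_mul, partialInner_sub_kronecker_self hu, Matrix.mul_zero,
      trace_zero]
  have pythagoras : hsNorm C ^ 2 = (Kᴴ * C).trace.re := by
    rw [← Complex.ofReal_re (hsNorm C ^ 2), ← trace_conjTranspose_mul_self]
    conv_lhs => rw [hC, conjTranspose_sub, Matrix.sub_mul, trace_sub, ← hC, orthogonal, sub_zero]
  have le_mul : hsNorm C ^ 2 ≤ hsNorm K * hsNorm C :=
    pythagoras.trans_le (trace_conjTranspose_mul_re_le K C)
  nlinarith [hsNorm_nonneg C, hsNorm_nonneg K]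

end PartialInner

section Place

variable {ι x r : Type*} [Fintype ι]

/-- The tensor product `⨂ᵢ F i` over an arbitrary finite family of copies of `X`. -/
def piKronecker (F : ι → Matrix x x ℂ) : Matrix (ι → x) (ι → x) ℂ :=
  of fun s t => ∏ i, F i (s i) (t i)

theorem conjTranspose_piKronecker (F : ι → Matrix x x ℂ) :
    (piKronecker F)ᴴ = piKronecker fun i => (F i)ᴴ := by
  ext s t
  simp only [conjTranspose_apply, piKronecker, of_apply, star_prod]

theorem isHermitian_piKronecker_kronecker {g : Matrix x x ℂ} {h : Matrix r r ℂ}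
    (hg : g.IsHermitian) (hh : h.IsHermitian) :
    (piKronecker (fun _ : ι => g) ⊗ₖ h).IsHermitian := by
  rw [Matrix.IsHermitian, conjTranspose_kronecker, conjTranspose_piKronecker, hg.eq, hh.eq]

theorem piKronecker_mul [Fintype x] [DecidableEq ι] (F G : ι → Matrix x x ℂ) :
    piKronecker F * piKronecker G = piKronecker (F * G) := by
  ext s t
  simp only [piKronecker, mul_apply, of_apply, Pi.mul_apply, ← Finset.prod_mul_distrib]
  exact (Fintype.prod_sum fun i p => F i (s i) p * G i p (t i)).symm

theorem posSemidef_piKronecker [Finite x] {F : ι → Matrix x x ℂ} (hF : ∀ i, (F i).PosSemidef) :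
    (piKronecker F).PosSemidef := by
  classical
  cases nonempty_fintype x
  choose C hC using fun i => CStarAlgebra.nonneg_iff_eq_star_mul_self.mp (hF i).nonneg
  have h : piKronecker F = (piKronecker C)ᴴ * piKronecker C := by
    rw [conjTranspose_piKronecker, piKronecker_mul]
    exact congrArg piKronecker (funext hC)
  rw [h]
  exact posSemidef_conjTranspose_mul_self _

variable [DecidableEq ι]

theorem piKronecker_const_mul [Fintype x] (u v : Matrix x x ℂ) :
    piKronecker (fun _ : ι => u * v) = piKronecker (fun _ => u) * piKronecker fun _ => v :=
  (piKronecker_mul _ _).symm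

theorem trace_piKronecker [Fintype x] (F : ι → Matrix x x ℂ) :
    (piKronecker F).trace = ∏ i, (F i).trace :=
  (Fintype.prod_sum fun i p => F i p p).symm

theorem hsNorm_piKronecker_const [Fintype x] (u : Matrix x x ℂ) :
    hsNorm (piKronecker fun _ : ι => u) = hsNorm u ^ Fintype.card ι := by
  refine (sq_eq_sq₀ (hsNorm_nonneg _) (pow_nonneg (hsNorm_nonneg u) _)).mp
    (Complex.ofReal_injective ?_)
  rw [← trace_conjTranspose_mul_self, conjTranspose_piKronecker, piKronecker_mul,
    trace_piKronecker]
  simp only [Pi.mul_apply, trace_conjTranspose_mul_self, Finset.prod_const, Finset.card_univ]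
  push_cast
  ring

theorem hsNorm_piKronecker_kronecker_sq [Fintype x] [DecidableEq x] [Fintype r] [DecidableEq r]
    {g : Matrix x x ℂ} (hg : hsNorm (g ^ 2) = 1) (h : Matrix r r ℂ) :
    hsNorm ((piKronecker (fun _ : ι => g) ⊗ₖ h) ^ 2) = hsNorm (h ^ 2) := by
  rw [kronecker_pow, hsNorm_kronecker, pow_two (piKronecker _), ← piKronecker_const_mul,
    ← pow_two, hsNorm_piKronecker_const, hg, one_pow, one_mul]

/-- `place a u K` acts as `K` on the `a`-th copy of `X` and on `R`, and as `u` on each of the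
other copies of `X`. -/
def place (a : ι) (u : Matrix x x ℂ) :
    Matrix (x × r) (x × r) ℂ →ₗ[ℂ] Matrix ((ι → x) × r) ((ι → x) × r) ℂ where
  toFun K := of fun s t =>
    K (s.1 a, s.2) (t.1 a, t.2) * ∏ i ∈ Finset.univ.erase a, u (s.1 i) (t.1 i)
  map_add' K L := by
    ext s t
    simp only [of_apply, Matrix.add_apply, add_mul]
  map_smul' c K := by
    ext s t
    simp only [of_apply, Matrix.smul_apply, smul_eq_mul, RingHom.id_apply, mul_assoc]

theorem place_apply (a : ι) (u : Matrix x x ℂ) (K : Matrix (x × r) (x × r) ℂ)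
    (s t : (ι → x) × r) : place a u K s t =
      K (s.1 a, s.2) (t.1 a, t.2) * ∏ i ∈ Finset.univ.erase a, u (s.1 i) (t.1 i) :=
  rfl

theorem place_kronecker (a : ι) (u k : Matrix x x ℂ) (l : Matrix r r ℂ) :
    place a u (k ⊗ₖ l) = piKronecker (Function.update (fun _ => u) a k) ⊗ₖ l := by
  ext s t
  have prod_erase : ∏ i ∈ Finset.univ.erase a, Function.update (fun _ => u) a k i (s.1 i) (t.1 i)
      = ∏ i ∈ Finset.univ.erase a, u (s.1 i) (t.1 i) :=
    Finset.prod_congr rfl fun i hi => by rw [Function.update_of_ne (Finset.ne_of_mem_erase hi)]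
  rw [place_apply, kronecker_apply, kronecker_apply, piKronecker, of_apply,
    ← Finset.mul_prod_erase _ _ (Finset.mem_univ a), prod_erase, Function.update_self]
  ring

theorem place_self_kronecker (a : ι) (u : Matrix x x ℂ) (l : Matrix r r ℂ) :
    place a u (u ⊗ₖ l) = piKronecker (fun _ => u) ⊗ₖ l := by
  rw [place_kronecker, Function.update_eq_self]

theorem conjTranspose_place (a : ι) (u : Matrix x x ℂ) (K : Matrix (x × r) (x × r) ℂ) :
    (place a u K)ᴴ = place a uᴴ Kᴴ := by
  ext s t
  simp only [conjTranspose_apply, place_apply, star_mul', star_prod]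

theorem place_mul [Fintype x] [Fintype r] (a : ι) (u v : Matrix x x ℂ)
    (K L : Matrix (x × r) (x × r) ℂ) :
    place a u K * place a v L = place a (u * v) (K * L) := by
  induction K using kronecker_induction with
  | add K K' hK hK' => simp only [Matrix.add_mul, map_add, hK, hK']
  | kronecker k l =>
    induction L using kronecker_induction with
    | add L L' hL hL' => simp only [Matrix.mul_add, map_add, hL, hL']
    | kronecker k' l' =>
      rw [← mul_kronecker_mul, place_kronecker, place_kronecker, place_kronecker,
        ← mul_kronecker_mul, piKronecker_mul, ← Function.update_mul]
      rfl

theorem posSemidef_place [Finite x] [Finite r] (a : ι) {u : Matrix x x ℂ}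
    (hu : u.PosSemidef) {K : Matrix (x × r) (x × r) ℂ} (hK : K.PosSemidef) :
    (place a u K).PosSemidef := by
  classical
  cases nonempty_fintype x
  cases nonempty_fintype r
  obtain ⟨C, rfl⟩ := CStarAlgebra.nonneg_iff_eq_star_mul_self.mp hK.nonneg
  obtain ⟨D, rfl⟩ := CStarAlgebra.nonneg_iff_eq_star_mul_self.mp hu.nonneg
  rw [star_eq_conjTranspose, star_eq_conjTranspose, ← place_mul, ← conjTranspose_place]
  exact posSemidef_conjTranspose_mul_self _

variable [Fintype x] [Fintype r]

theorem place_conj (a : ι) (u g : Matrix x x ℂ) (h : Matrix r r ℂ)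
    (K : Matrix (x × r) (x × r) ℂ) :
    place a (g * u * g) ((g ⊗ₖ h) * K * (g ⊗ₖ h)) =
      (piKronecker (fun _ => g) ⊗ₖ h) * place a u K * (piKronecker (fun _ => g) ⊗ₖ h) := by
  rw [← place_mul, ← place_mul, place_self_kronecker]

theorem trace_place (a : ι) {u : Matrix x x ℂ} (hu : u.trace = 1)
    (K : Matrix (x × r) (x × r) ℂ) : (place a u K).trace = K.trace := by
  induction K using kronecker_induction with
  | add K L hK hL => simp only [map_add, trace_add, hK, hL]
  | kronecker k l =>
    rw [place_kronecker, trace_kronecker, trace_kronecker, trace_piKronecker,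
      Finset.prod_eq_single_of_mem a (Finset.mem_univ a) fun i _ hi => by
        rw [Function.update_of_ne hi, hu], Function.update_self]

theorem trace_conjTranspose_place_mul_place_self (a : ι) {u : Matrix x x ℂ} (hu : hsNorm u = 1)
    (K L : Matrix (x × r) (x × r) ℂ) :
    ((place a u K)ᴴ * place a u L).trace = (Kᴴ * L).trace := by
  rw [conjTranspose_place, place_mul,
    trace_place a (trace_conjTranspose_mul_self_of_hsNorm_eq_one hu)]

theorem trace_conjTranspose_place_mul_place_of_ne {a b : ι} (hab : a ≠ b) {u : Matrix x x ℂ}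
    (hu : hsNorm u = 1) (K L : Matrix (x × r) (x × r) ℂ) :
    ((place a u K)ᴴ * place b u L).trace = ((partialInner u K)ᴴ * partialInner u L).trace := by
  induction K using kronecker_induction with
  | add K K' hK hK' =>
    simp only [map_add, conjTranspose_add, Matrix.add_mul, trace_add, hK, hK']
  | kronecker k l =>
    induction L using kronecker_induction with
    | add L L' hL hL' => simp only [map_add, Matrix.mul_add, trace_add, hL, hL']
    | kronecker k' l' =>
      have trace_star : (kᴴ * u).trace = star (uᴴ * k).trace := by
        rw [← trace_conjTranspose, conjTranspose_mul, conjTranspose_conjTranspose]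
      rw [place_kronecker, place_kronecker, conjTranspose_kronecker, ← mul_kronecker_mul,
        trace_kronecker, conjTranspose_piKronecker, piKronecker_mul, trace_piKronecker,
        Finset.prod_eq_mul a b hab (fun i _ hi => ?_) (absurd (Finset.mem_univ a) ·)
          (absurd (Finset.mem_univ b) ·)]
      · simp only [Pi.mul_apply, Function.update_self, Function.update_of_ne hab,
          Function.update_of_ne hab.symm, partialInner_kronecker, conjTranspose_smul,
          Matrix.smul_mul, Matrix.mul_smul, trace_smul, smul_eq_mul, trace_star]
        ring
      · rw [Pi.mul_apply, Function.update_of_ne hi.1, Function.update_of_ne hi.2,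
          trace_conjTranspose_mul_self_of_hsNorm_eq_one hu]

theorem hsNorm_sum_place {u : Matrix x x ℂ} (hu : hsNorm u = 1) {K : Matrix (x × r) (x × r) ℂ}
    (hK : partialInner u K = 0) :
    hsNorm (∑ a : ι, place a u K) = √(Fintype.card ι) * hsNorm K := by
  have trace_place_mul (a b : ι) : ((place a u K)ᴴ * place b u K).trace =
      if a = b then (Kᴴ * K).trace else 0 := by
    split_ifs with hab
    · rw [hab, trace_conjTranspose_place_mul_place_self b hu]
    · rw [trace_conjTranspose_place_mul_place_of_ne hab hu, hK, Matrix.mul_zero, trace_zero]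
  refine (sq_eq_sq₀ (hsNorm_nonneg _) (mul_nonneg (Real.sqrt_nonneg _) (hsNorm_nonneg K))).mp
    (Complex.ofReal_injective ?_)
  rw [mul_pow, Real.sq_sqrt (Nat.cast_nonneg _), Complex.ofReal_mul,
    ← trace_conjTranspose_mul_self, ← trace_conjTranspose_mul_self, conjTranspose_sum]
  simp only [Matrix.sum_mul, Matrix.mul_sum, trace_sum, trace_place_mul,
    Finset.sum_ite_eq', Finset.mem_univ, if_true, Finset.sum_const, Finset.card_univ,
    nsmul_eq_mul, Complex.ofReal_natCast]

end Place

section Split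

variable (ι : Type*) {x r : Type*} [Fintype ι]

/-- The decoupling map `K ↦ w^{⊗ ι} ⊗ Tr_X[(tᴴ ⊗ 1) K]`; a state is decoupled from `X` by `t = 1`
and `w` a density matrix. -/
def decouple [Fintype x] (t w : Matrix x x ℂ) :
    Matrix (x × r) (x × r) ℂ →ₗ[ℂ] Matrix ((ι → x) × r) ((ι → x) × r) ℂ :=
  kroneckerBilinear (R := ℂ) (piKronecker fun _ => w) ∘ₗ partialInner t

theorem decouple_apply [Fintype x] (t w : Matrix x x ℂ) (K : Matrix (x × r) (x × r) ℂ) :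
    decouple ι t w K = piKronecker (fun _ => w) ⊗ₖ partialInner t K :=
  rfl

variable [DecidableEq ι]

/-- The convex split map `K ↦ |ι|⁻¹ ∑ₐ place a u K`. -/
noncomputable def split (u : Matrix x x ℂ) :
    Matrix (x × r) (x × r) ℂ →ₗ[ℂ] Matrix ((ι → x) × r) ((ι → x) × r) ℂ :=
  (Fintype.card ι : ℂ)⁻¹ • ∑ a : ι, place a u

/-- The deviation of a convex split from its decoupled limit. On states it is used with `t = 1`;
conjugating by fourth roots turns it into the case `t = w`, where it is a Hilbert–Schmidt
contraction. -/
noncomputable def deviation [Fintype x] (t w : Matrix x x ℂ) :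
    Matrix (x × r) (x × r) ℂ →ₗ[ℂ] Matrix ((ι → x) × r) ((ι → x) × r) ℂ :=
  split ι w - decouple ι t w

theorem split_apply (u : Matrix x x ℂ) (K : Matrix (x × r) (x × r) ℂ) :
    split ι u K = (Fintype.card ι : ℂ)⁻¹ • ∑ a : ι, place a u K := by
  rw [split, LinearMap.smul_apply, LinearMap.sum_apply]

variable [Fintype x]

theorem deviation_kronecker (t w k : Matrix x x ℂ) (l : Matrix r r ℂ) :
    deviation ι t w (k ⊗ₖ l) =
      ((Fintype.card ι : ℂ)⁻¹ • ∑ a : ι, piKronecker (Function.update (fun _ => w) a k) -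
        (tᴴ * k).trace • piKronecker fun _ => w) ⊗ₖ l := by
  rw [deviation, LinearMap.sub_apply, split_apply, decouple_apply, partialInner_kronecker]
  simp only [place_kronecker]
  ext s t
  simp only [Matrix.sub_apply, Matrix.smul_apply, Matrix.sum_apply, kroneckerMap_apply, smul_eq_mul,
    sub_mul, Finset.sum_mul, Finset.mul_sum, mul_assoc]
  rw [mul_left_comm]

theorem deviation_self_apply [Nonempty ι] (u : Matrix x x ℂ) (K : Matrix (x × r) (x × r) ℂ) :
    deviation ι u u K =
      (Fintype.card ι : ℂ)⁻¹ • ∑ a : ι, place a u (K - u ⊗ₖ partialInner u K) := by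
  simp only [map_sub, place_self_kronecker, Finset.sum_sub_distrib, Finset.sum_const,
    Finset.card_univ, smul_sub, ← Nat.cast_smul_eq_nsmul ℂ,
    inv_smul_smul₀ (Nat.cast_ne_zero.mpr (Fintype.card_ne_zero (α := ι)) : (_ : ℂ) ≠ 0)]
  rw [deviation, LinearMap.sub_apply, split_apply, decouple_apply]

variable [Fintype r]

theorem isPosTracePreserving_split [Nonempty ι] {α : Matrix x x ℂ} (hα : IsDensity α) :
    IsPosTracePreserving (split (r := r) ι α) where
  posSemidef {P} hP := by
    rw [split_apply, ← Complex.ofReal_natCast, ← Complex.ofReal_inv]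
    exact (posSemidef_sum _ fun a _ => posSemidef_place a hα.1 hP).smul
      (Complex.zero_le_real.mpr (inv_nonneg.mpr (Nat.cast_nonneg _)))
  trace T := by
    rw [split_apply, trace_smul, trace_sum, Finset.sum_congr rfl fun a _ => trace_place a hα.2 T,
      Finset.sum_const, Finset.card_univ, nsmul_eq_mul, smul_eq_mul,
      inv_mul_cancel_left₀ (Nat.cast_ne_zero.mpr Fintype.card_ne_zero)]

theorem isPosTracePreserving_kronecker {k : Type*} [Fintype k] {P : Matrix k k ℂ}
    (hP : IsDensity P) :
    IsPosTracePreserving (kroneckerBilinear (R := ℂ) P : Matrix r r ℂ →ₗ[ℂ] _) where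
  posSemidef hQ := hP.1.kronecker hQ
  trace T := (trace_kronecker P T).trans (by rw [hP.2, one_mul])

theorem isDensity_piKronecker {α : Matrix x x ℂ} (hα : IsDensity α) :
    IsDensity (piKronecker fun _ : ι => α) :=
  ⟨posSemidef_piKronecker fun _ => hα.1, by
    rw [trace_piKronecker, Finset.prod_congr rfl fun _ _ => hα.2, Finset.prod_const_one]⟩

theorem isPosTracePreserving_decouple [DecidableEq x] {α : Matrix x x ℂ} (hα : IsDensity α) :
    IsPosTracePreserving (decouple (r := r) ι 1 α) :=
  (isPosTracePreserving_kronecker (isDensity_piKronecker ι hα)).comp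
    isPosTracePreserving_partialInner_one

theorem hasTraceNormBound_deviation [Nonempty ι] [DecidableEq x] [DecidableEq r]
    {α : Matrix x x ℂ} (hα : IsDensity α) :
    HasTraceNormBound (deviation (r := r) ι 1 α) (1 + 1) :=
  (isPosTracePreserving_split ι hα).hasTraceNormBound.sub
    (isPosTracePreserving_decouple ι hα).hasTraceNormBound

theorem hsNorm_deviation_self_le [Nonempty ι] {u : Matrix x x ℂ} (hu : hsNorm u = 1)
    (K : Matrix (x × r) (x × r) ℂ) :
    hsNorm (deviation ι u u K) ≤ hsNorm K / √(Fintype.card ι) := by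
  have card_pos : (0 : ℝ) < Fintype.card ι := Nat.cast_pos.mpr Fintype.card_pos
  rw [deviation_self_apply, ← Complex.ofReal_natCast, ← Complex.ofReal_inv, hsNorm_smul,
    hsNorm_sum_place hu (partialInner_sub_kronecker_self hu K),
    abs_of_pos (inv_pos.mpr card_pos)]
  calc (Fintype.card ι : ℝ)⁻¹ * (√(Fintype.card ι) * hsNorm (K - u ⊗ₖ partialInner u K))
      = hsNorm (K - u ⊗ₖ partialInner u K) / √(Fintype.card ι) := by
        field_simp
        rw [Real.sq_sqrt card_pos.le]
    _ ≤ hsNorm K / √(Fintype.card ι) := by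
        gcongr
        exact hsNorm_sub_kronecker_partialInner_le hu K

theorem decouple_conj (t u g : Matrix x x ℂ) (h : Matrix r r ℂ)
    (K : Matrix (x × r) (x × r) ℂ) :
    decouple ι t (g * u * g) ((g ⊗ₖ h) * K * (g ⊗ₖ h)) =
      (piKronecker (fun _ => g) ⊗ₖ h) * decouple ι (gᴴ * t * gᴴ) u K *
        (piKronecker (fun _ => g) ⊗ₖ h) := by
  rw [decouple_apply, decouple_apply, partialInner_conj, piKronecker_const_mul,
    piKronecker_const_mul, mul_kronecker_mul, mul_kronecker_mul]

theorem deviation_conj (t u g : Matrix x x ℂ) (h : Matrix r r ℂ)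
    (K : Matrix (x × r) (x × r) ℂ) :
    deviation ι t (g * u * g) ((g ⊗ₖ h) * K * (g ⊗ₖ h)) =
      (piKronecker (fun _ => g) ⊗ₖ h) * deviation ι (gᴴ * t * gᴴ) u K *
        (piKronecker (fun _ => g) ⊗ₖ h) := by
  simp only [deviation, LinearMap.sub_apply, split_apply, place_conj, decouple_conj,
    Matrix.mul_sub, Matrix.sub_mul, Matrix.mul_smul, Matrix.smul_mul, Matrix.mul_sum,
    Matrix.sum_mul]

variable [DecidableEq x]

theorem deviation_conj_fourthRoot {P : Matrix x x ℂ} (hP : P.PosSemidef) (h : Matrix r r ℂ)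
    (K : Matrix (x × r) (x × r) ℂ) :
    deviation ι 1 P ((fourthRoot P ⊗ₖ h) * K * (fourthRoot P ⊗ₖ h)) =
      (piKronecker (fun _ => fourthRoot P) ⊗ₖ h) *
        deviation ι (fourthRoot P ^ 2) (fourthRoot P ^ 2) K *
        (piKronecker (fun _ => fourthRoot P) ⊗ₖ h) := by
  have mul_mul_eq : fourthRoot P * fourthRoot P ^ 2 * fourthRoot P = P := by
    rw [← pow_succ', ← pow_succ]
    exact fourthRoot_pow_four hP
  have conj := deviation_conj ι 1 (fourthRoot P ^ 2) (fourthRoot P) h K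
  rwa [mul_mul_eq, (isHermitian_fourthRoot P).eq, Matrix.mul_one, ← pow_two] at conj

variable [DecidableEq r]

theorem traceNorm_deviation_conj_le [Nonempty ι] {α : Matrix x x ℂ} (hα : IsDensity α)
    {h : Matrix r r ℂ} (hh : h.IsHermitian) {K : Matrix (x × r) (x × r) ℂ}
    (hK : ((fourthRoot α ⊗ₖ h) * K * (fourthRoot α ⊗ₖ h)).IsHermitian) :
    traceNorm (deviation ι 1 α ((fourthRoot α ⊗ₖ h) * K * (fourthRoot α ⊗ₖ h))) ≤
      hsNorm (h ^ 2) * (hsNorm K / √(Fintype.card ι)) := by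
  set g := fourthRoot α
  set G := piKronecker (fun _ : ι => g) ⊗ₖ h
  have hsNorm_g_sq : hsNorm (g ^ 2) = 1 := hsNorm_fourthRoot_sq_of_isDensity hα
  have isHermitian_G : G.IsHermitian :=
    isHermitian_piKronecker_kronecker (isHermitian_fourthRoot α) hh
  have isHermitian_deviation := (hasTraceNormBound_deviation ι hα).isHermitian hK
  rw [deviation_conj_fourthRoot ι hα.1] at isHermitian_deviation ⊢
  calc traceNorm (G * deviation ι (g ^ 2) (g ^ 2) K * G)
      ≤ hsNorm (G ^ 2) * hsNorm (deviation ι (g ^ 2) (g ^ 2) K) :=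
        traceNorm_mul_mul_le isHermitian_G isHermitian_deviation
    _ ≤ hsNorm (h ^ 2) * (hsNorm K / √(Fintype.card ι)) := by
        rw [hsNorm_piKronecker_kronecker_sq hsNorm_g_sq]
        exact mul_le_mul_of_nonneg_left (hsNorm_deviation_self_le ι hsNorm_g_sq K)
          (hsNorm_nonneg _)

theorem traceNorm_deviation_le_of_smoothD2_lt [Nonempty ι] {α : Matrix x x ℂ}
    (hα : IsDensity α) {ω : Matrix (x × r) (x × r) ℂ} (hω : ω.IsHermitian)
    {t : ℝ} (ht : 0 < t) (htrace : ω.trace.re = t) {θ : Matrix r r ℂ} (hθ : θ.PosSemidef)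
    (hθt : θ.trace.re ≤ t) {ε : ℝ} (hε : 0 < ε)
    (h : smoothD2 ε ω (α ⊗ₖ θ) - ((Real.logb 2 t : ℝ) : EReal)
      + ((Real.logb 2 (ε ^ (-2 : ℤ)) : ℝ) : EReal) <
        ((Real.logb 2 (Fintype.card ι) : ℝ) : EReal)) :
    traceNorm (deviation ι 1 α ω) ≤ 3 * (ε * t) := by
  refine ((hasTraceNormBound_deviation ι hα).traceNorm_le_of_smoothD2_lt (by norm_num) hε hω
    (hα.1.kronecker hθ) (Nat.cast_pos.mpr Fintype.card_pos) ht htrace (fun K hK => ?_) h).trans_eq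
    (by norm_num)
  rw [fourthRoot_kronecker hα.1 hθ] at hK ⊢
  refine (traceNorm_deviation_conj_le ι hα (isHermitian_fourthRoot θ) hK).trans ?_
  rw [hsNorm_fourthRoot_sq hθ]
  have := hsNorm_nonneg K
  gcongr

end Split

section Swap

variable {x y z m : Type*}

/-- The exchange of the first two tensor factors, identifying matrices on `X ⊗ Y ⊗ M` with
matrices on `Y ⊗ X ⊗ M`. -/
def swap : Matrix (x × y × m) (x × y × m) ℂ →ₗ[ℂ] Matrix (y × x × m) (y × x × m) ℂ where
  toFun K := K.submatrix (fun p => (p.2.1, p.1, p.2.2)) fun p => (p.2.1, p.1, p.2.2)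
  map_add' _ _ := rfl
  map_smul' _ _ := rfl

/-- The action on the second tensor factor of a map defined for the first one. -/
def onSecond (F : Matrix (y × x × m) (y × x × m) ℂ →ₗ[ℂ] Matrix (z × x × m) (z × x × m) ℂ) :
    Matrix (x × y × m) (x × y × m) ℂ →ₗ[ℂ] Matrix (x × z × m) (x × z × m) ℂ :=
  swap ∘ₗ F ∘ₗ swap

theorem swap_swap (K : Matrix (x × y × m) (x × y × m) ℂ) : swap (swap K) = K :=
  rfl

theorem swap_kronecker (k : Matrix x x ℂ) (l : Matrix y y ℂ) (q : Matrix m m ℂ) :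
    swap (k ⊗ₖ (l ⊗ₖ q)) = l ⊗ₖ (k ⊗ₖ q) := by
  ext s t
  exact mul_left_comm _ _ _

theorem partialInner_swap_kronecker [Fintype x] [Finite m] (t : Matrix x x ℂ) (l : Matrix y y ℂ)
    (K : Matrix (x × m) (x × m) ℂ) :
    partialInner t (swap (l ⊗ₖ K)) = l ⊗ₖ partialInner t K := by
  induction K using kronecker_induction with
  | add K L hK hL => simp only [kronecker_add, map_add, hK, hL]
  | kronecker k q =>
    rw [swap_kronecker, partialInner_kronecker, partialInner_kronecker, kronecker_smul]

variable (ι : Type*) [Fintype ι] [DecidableEq ι]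

theorem deviation_swap_kronecker [Fintype x] [Finite m] (t w : Matrix x x ℂ) (l : Matrix y y ℂ)
    (K : Matrix (x × m) (x × m) ℂ) :
    deviation ι t w (swap (l ⊗ₖ K)) = swap (l ⊗ₖ deviation ι t w K) := by
  induction K using kronecker_induction with
  | add K L hK hL => simp only [kronecker_add, map_add, hK, hL]
  | kronecker k q =>
    rw [swap_kronecker, deviation_kronecker, deviation_kronecker, swap_kronecker]

theorem onSecond_deviation_kronecker [Fintype y] [Finite m] (t w : Matrix y y ℂ)
    (k : Matrix x x ℂ) (L : Matrix (y × m) (y × m) ℂ) :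
    onSecond (deviation ι t w) (k ⊗ₖ L) = k ⊗ₖ deviation ι t w L := by
  rw [onSecond, LinearMap.comp_apply, LinearMap.comp_apply, deviation_swap_kronecker, swap_swap]

theorem partialInner_onSecond_deviation [Fintype x] [Fintype y] [Finite m] (s : Matrix x x ℂ)
    (t w : Matrix y y ℂ) (K : Matrix (x × y × m) (x × y × m) ℂ) :
    partialInner s (onSecond (deviation ι t w) K) = deviation ι t w (partialInner s K) := by
  induction K using kronecker_induction with
  | add K L hK hL => simp only [map_add, hK, hL]
  | kronecker k L =>
    rw [onSecond_deviation_kronecker, partialInner_kronecker, partialInner_kronecker, map_smul]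

variable [Fintype x] [Fintype y] [Fintype m] [Fintype z]

theorem swap_mul (K L : Matrix (x × y × m) (x × y × m) ℂ) : swap (K * L) = swap K * swap L := by
  let e : y × x × m ≃ x × y × m :=
    ⟨fun p => (p.2.1, p.1, p.2.2), fun p => (p.2.1, p.1, p.2.2), fun _ => rfl, fun _ => rfl⟩
  exact (submatrix_mul_equiv K L e e e).symm

theorem isPosTracePreserving_swap :
    IsPosTracePreserving (swap : Matrix (x × y × m) (x × y × m) ℂ →ₗ[ℂ] _) where
  posSemidef hP := hP.submatrix _
  trace T := by
    simp only [Matrix.trace, diag, Fintype.sum_prod_type]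
    exact Finset.sum_comm

theorem hsNorm_swap (K : Matrix (x × y × m) (x × y × m) ℂ) : hsNorm (swap K) = hsNorm K := by
  refine hsNorm_eq_of_trace_eq ?_
  rw [← isPosTracePreserving_swap.trace (Kᴴ * K), swap_mul]
  rfl

theorem onSecond_deviation_conj_fourthRoot [DecidableEq y] {P : Matrix y y ℂ}
    (hP : P.PosSemidef) (g : Matrix x x ℂ) (h : Matrix m m ℂ)
    (K : Matrix (x × y × m) (x × y × m) ℂ) :
    onSecond (deviation ι 1 P)
        ((g ⊗ₖ (fourthRoot P ⊗ₖ h)) * K * (g ⊗ₖ (fourthRoot P ⊗ₖ h))) =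
      (g ⊗ₖ (piKronecker (fun _ => fourthRoot P) ⊗ₖ h)) *
        onSecond (deviation ι (fourthRoot P ^ 2) (fourthRoot P ^ 2)) K *
        (g ⊗ₖ (piKronecker (fun _ => fourthRoot P) ⊗ₖ h)) := by
  simp only [onSecond, LinearMap.comp_apply, swap_mul, swap_kronecker,
    deviation_conj_fourthRoot ι hP]

theorem HasTraceNormBound.onSecond [DecidableEq x] [DecidableEq y] [DecidableEq m]
    [DecidableEq z]
    {F : Matrix (y × x × m) (y × x × m) ℂ →ₗ[ℂ] Matrix (z × x × m) (z × x × m) ℂ} {c : ℝ}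
    (hF : HasTraceNormBound F c) (hc : 0 ≤ c) : HasTraceNormBound (onSecond F) c := by
  have h := isPosTracePreserving_swap.hasTraceNormBound.comp
    (hF.comp isPosTracePreserving_swap.hasTraceNormBound hc) zero_le_one
  rwa [mul_one, one_mul] at h

end Swap

section Tripartite

variable {ι κ x y m : Type*} [Fintype ι] [DecidableEq ι] [Fintype κ] [DecidableEq κ]
  [Fintype x] [DecidableEq x] [Fintype y] [DecidableEq y] [Fintype m] [DecidableEq m]
  {α : Matrix x x ℂ} {β : Matrix y y ℂ}

theorem hasTraceNormBound_deviation_comp_onSecond [Nonempty ι] [Nonempty κ] (hα : IsDensity α)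
    (hβ : IsDensity β) :
    HasTraceNormBound (deviation (r := (κ → y) × m) ι 1 α ∘ₗ onSecond (deviation κ 1 β))
      ((1 + 1) * (1 + 1)) :=
  (hasTraceNormBound_deviation ι hα).comp
    ((hasTraceNormBound_deviation κ hβ).onSecond (by norm_num)) (by norm_num)

theorem traceNorm_deviation_onSecond_deviation_conj_le [Nonempty ι] [Nonempty κ]
    (hα : IsDensity α) (hβ : IsDensity β) {h : Matrix m m ℂ} (hh : h.IsHermitian)
    {K : Matrix (x × y × m) (x × y × m) ℂ}
    (hK : ((fourthRoot α ⊗ₖ (fourthRoot β ⊗ₖ h)) * K *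
      (fourthRoot α ⊗ₖ (fourthRoot β ⊗ₖ h))).IsHermitian) :
    traceNorm (deviation ι 1 α (onSecond (deviation κ 1 β)
      ((fourthRoot α ⊗ₖ (fourthRoot β ⊗ₖ h)) * K * (fourthRoot α ⊗ₖ (fourthRoot β ⊗ₖ h))))) ≤
      hsNorm (h ^ 2) * (hsNorm K / √(Fintype.card ι * Fintype.card κ)) := by
  set g := fourthRoot β
  set H := piKronecker (fun _ : κ => g) ⊗ₖ h
  have hsNorm_g_sq : hsNorm (g ^ 2) = 1 := hsNorm_fourthRoot_sq_of_isDensity hβ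
  have isHermitian_onSecond :=
    ((hasTraceNormBound_deviation κ hβ).onSecond (by norm_num)).isHermitian hK
  rw [onSecond_deviation_conj_fourthRoot κ hβ.1] at isHermitian_onSecond ⊢
  calc traceNorm (deviation ι 1 α ((fourthRoot α ⊗ₖ H) *
        onSecond (deviation κ (g ^ 2) (g ^ 2)) K * (fourthRoot α ⊗ₖ H)))
      ≤ hsNorm (H ^ 2) *
          (hsNorm (onSecond (deviation κ (g ^ 2) (g ^ 2)) K) / √(Fintype.card ι)) :=
        traceNorm_deviation_conj_le ι hα
          (isHermitian_piKronecker_kronecker (isHermitian_fourthRoot β) hh) isHermitian_onSecond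
    _ ≤ hsNorm (h ^ 2) * (hsNorm K / √(Fintype.card κ) / √(Fintype.card ι)) := by
        rw [hsNorm_piKronecker_kronecker_sq hsNorm_g_sq]
        gcongr
        · exact hsNorm_nonneg _
        · exact (hsNorm_swap _).trans_le
            ((hsNorm_deviation_self_le κ hsNorm_g_sq _).trans_eq (by rw [hsNorm_swap]))
    _ = hsNorm (h ^ 2) * (hsNorm K / √(Fintype.card ι * Fintype.card κ)) := by
        rw [div_div, mul_comm √_, Real.sqrt_mul (Nat.cast_nonneg _)]

theorem traceNorm_deviation_onSecond_deviation_le_of_smoothD2_lt [Nonempty ι] [Nonempty κ]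
    (hα : IsDensity α) (hβ : IsDensity β) {ω : Matrix (x × y × m) (x × y × m) ℂ}
    (hω : ω.IsHermitian) (htrace : 0 < ω.trace.re) {θ : Matrix m m ℂ} (hθ : θ.PosSemidef)
    (hθω : θ.trace.re ≤ ω.trace.re) {ε : ℝ} (hε : 0 < ε)
    (h : smoothD2 ε ω (α ⊗ₖ (β ⊗ₖ θ)) - ((Real.logb 2 ω.trace.re : ℝ) : EReal)
      + ((Real.logb 2 (ε ^ (-2 : ℤ)) : ℝ) : EReal) <
        ((Real.logb 2 (Fintype.card ι * Fintype.card κ) : ℝ) : EReal)) :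
    traceNorm (deviation ι 1 α (onSecond (deviation κ 1 β) ω)) ≤ 5 * (ε * ω.trace.re) := by
  refine ((hasTraceNormBound_deviation_comp_onSecond hα hβ).traceNorm_le_of_smoothD2_lt
    (by norm_num) hε hω (hα.1.kronecker (hβ.1.kronecker hθ)) (by positivity) htrace rfl
    (fun K hK => ?_) h).trans_eq (by norm_num)
  rw [fourthRoot_kronecker hα.1 (hβ.1.kronecker hθ), fourthRoot_kronecker hβ.1 hθ] at hK ⊢
  refine (traceNorm_deviation_onSecond_deviation_conj_le hα hβ (isHermitian_fourthRoot θ)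
    hK).trans ?_
  rw [hsNorm_fourthRoot_sq hθ]
  have := hsNorm_nonneg K
  gcongr

end Tripartite

section Marginals

variable {x y m : Type*}

theorem margXM_eq_partialInner_swap [Fintype y] [DecidableEq y]
    (ρ : Matrix (x × y × m) (x × y × m) ℂ) : margXM ρ = partialInner 1 (swap ρ) := by
  ext i j
  exact (partialInner_one_apply (swap ρ) i j).symm

theorem margYM_eq_partialInner [Fintype x] [DecidableEq x]
    (ρ : Matrix (x × y × m) (x × y × m) ℂ) : margYM ρ = partialInner 1 ρ := by
  ext i j
  exact (partialInner_one_apply ρ i j).symm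

theorem margM_eq_partialInner_margXM [Fintype x] [DecidableEq x] [Fintype y]
    (ρ : Matrix (x × y × m) (x × y × m) ℂ) : margM ρ = partialInner 1 (margXM ρ) := by
  ext i j
  exact (partialInner_one_apply (margXM ρ) i j).symm

theorem isHermitian_margXM [Fintype y] {ρ : Matrix (x × y × m) (x × y × m) ℂ}
    (hρ : ρ.IsHermitian) : (margXM ρ).IsHermitian := by
  ext i j
  simp only [conjTranspose_apply, margXM, of_apply, star_sum, hρ.apply]

theorem isHermitian_margYM [Fintype x] {ρ : Matrix (x × y × m) (x × y × m) ℂ}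
    (hρ : ρ.IsHermitian) : (margYM ρ).IsHermitian := by
  ext i j
  simp only [conjTranspose_apply, margYM, of_apply, star_sum, hρ.apply]

variable [Fintype x] [Fintype y]

theorem posSemidef_margM {ρ : Matrix (x × y × m) (x × y × m) ℂ} (hρ : ρ.PosSemidef) :
    (margM ρ).PosSemidef := by
  have margM_eq : margM ρ = ∑ a, ∑ b, ρ.submatrix (fun c => (a, b, c)) fun c => (a, b, c) := by
    ext i j
    simp only [margM, of_apply, Matrix.sum_apply, submatrix_apply]
  rw [margM_eq]
  exact posSemidef_sum _ fun a _ => posSemidef_sum _ fun b _ => hρ.submatrix _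

variable [Fintype m]

theorem trace_margXM (ρ : Matrix (x × y × m) (x × y × m) ℂ) : (margXM ρ).trace = ρ.trace := by
  simp only [Matrix.trace, diag, margXM, of_apply, Fintype.sum_prod_type]
  exact Finset.sum_congr rfl fun _ _ => Finset.sum_comm

theorem trace_margYM (ρ : Matrix (x × y × m) (x × y × m) ℂ) : (margYM ρ).trace = ρ.trace := by
  classical
  rw [margYM_eq_partialInner, isPosTracePreserving_partialInner_one.trace]

theorem trace_margM (ρ : Matrix (x × y × m) (x × y × m) ℂ) : (margM ρ).trace = ρ.trace := by
  classical
  rw [margM_eq_partialInner_margXM, isPosTracePreserving_partialInner_one.trace, trace_margXM]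

end Marginals

section SplitStates

variable {x y m : Type*}

theorem convexSplitState_eq (A B : ℕ) (ρ : Matrix (x × y × m) (x × y × m) ℂ)
    (α : Matrix x x ℂ) (β : Matrix y y ℂ) :
    convexSplitState A B ρ α β = split (Fin A) α (onSecond (split (Fin B) β) ρ) := by
  have placed_eq (a : Fin A) (b : Fin B) :
      placed ρ α β a b = place a α (swap (place b β (swap ρ))) := by
    ext s t
    exact mul_right_comm _ _ _
  simp only [onSecond, LinearMap.comp_apply, split_apply, map_smul, map_sum, placed_eq,
    convexSplitState, Fintype.card_fin, mul_inv, mul_smul, Finset.smul_sum]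
  rw [Finset.sum_comm]
  exact Finset.sum_congr rfl fun b _ => Finset.sum_congr rfl fun a _ => smul_comm _ _ _

variable [Fintype x] [DecidableEq x] [Fintype y] [DecidableEq y] [Finite m]

theorem decoupledState_eq (A B : ℕ) (ρ : Matrix (x × y × m) (x × y × m) ℂ) (α : Matrix x x ℂ)
    (β : Matrix y y ℂ) :
    decoupledState A B ρ α β = decouple (Fin A) 1 α (onSecond (decouple (Fin B) 1 β) ρ) := by
  rw [onSecond, LinearMap.comp_apply, LinearMap.comp_apply, decouple_apply, decouple_apply,
    partialInner_swap_kronecker, ← margXM_eq_partialInner_swap, ← margM_eq_partialInner_margXM]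
  rfl

theorem convexSplitState_sub_decoupledState (A B : ℕ) (ρ : Matrix (x × y × m) (x × y × m) ℂ)
    (α : Matrix x x ℂ) (β : Matrix y y ℂ) :
    convexSplitState A B ρ α β - decoupledState A B ρ α β =
      deviation (Fin A) 1 α (onSecond (deviation (Fin B) 1 β) ρ) +
      swap (tensorPow B β ⊗ₖ deviation (Fin A) 1 α (margXM ρ)) +
      tensorPow A α ⊗ₖ deviation (Fin B) 1 β (margYM ρ) := by
  have deviation_swap : swap (tensorPow B β ⊗ₖ deviation (Fin A) 1 α (margXM ρ)) =
      deviation (Fin A) 1 α (onSecond (decouple (Fin B) 1 β) ρ) := by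
    rw [← deviation_swap_kronecker, margXM_eq_partialInner_swap]
    rfl
  have decouple_deviation : tensorPow A α ⊗ₖ deviation (Fin B) 1 β (margYM ρ) =
      decouple (Fin A) 1 α (onSecond (deviation (Fin B) 1 β) ρ) := by
    rw [decouple_apply, partialInner_onSecond_deviation, margYM_eq_partialInner]
    rfl
  rw [deviation_swap, decouple_deviation, convexSplitState_eq, decoupledState_eq]
  simp only [deviation, onSecond, LinearMap.comp_apply, LinearMap.sub_apply, map_sub]
  abel

end SplitStates

section MarginalTerms

variable {x y m : Type*} [Fintype x] [DecidableEq x] [Fintype y] [DecidableEq y]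
  [Fintype m] [DecidableEq m]

theorem hasTraceNormBound_tensorPow_kronecker (A : ℕ) {α : Matrix x x ℂ} (hα : IsDensity α) :
    HasTraceNormBound (kroneckerBilinear (R := ℂ) (tensorPow A α) : Matrix m m ℂ →ₗ[ℂ] _) 1 :=
  (isPosTracePreserving_kronecker (isDensity_piKronecker (Fin A) hα)).hasTraceNormBound

theorem hasTraceNormBound_swap_tensorPow_kronecker (B : ℕ) {β : Matrix y y ℂ}
    (hβ : IsDensity β) :
    HasTraceNormBound
      (swap ∘ₗ (kroneckerBilinear (R := ℂ) (tensorPow B β) : Matrix (x × m) (x × m) ℂ →ₗ[ℂ] _))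
      1 :=
  (isPosTracePreserving_swap.comp
    (isPosTracePreserving_kronecker (isDensity_piKronecker (Fin B) hβ))).hasTraceNormBound

theorem traceNorm_convexSplitState_sub_decoupledState_le {A B : ℕ} [NeZero A] [NeZero B]
    {α : Matrix x x ℂ} {β : Matrix y y ℂ} (hα : IsDensity α) (hβ : IsDensity β)
    {ρ : Matrix (x × y × m) (x × y × m) ℂ} (hρ : ρ.IsHermitian) :
    traceNorm (convexSplitState A B ρ α β - decoupledState A B ρ α β) ≤
      traceNorm (deviation (Fin A) 1 α (onSecond (deviation (Fin B) 1 β) ρ)) +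
      traceNorm (deviation (Fin A) 1 α (margXM ρ)) +
      traceNorm (deviation (Fin B) 1 β (margYM ρ)) := by
  have isHermitian_cross := (hasTraceNormBound_deviation_comp_onSecond (ι := Fin A) (κ := Fin B)
    hα hβ).isHermitian hρ
  have isHermitian_X := (hasTraceNormBound_deviation (Fin A) hα).isHermitian
    (isHermitian_margXM hρ)
  have isHermitian_Y := (hasTraceNormBound_deviation (Fin B) hβ).isHermitian
    (isHermitian_margYM hρ)
  have tensor_β := hasTraceNormBound_swap_tensorPow_kronecker (x := Fin A → x) (m := m) B hβ
  have tensor_α := hasTraceNormBound_tensorPow_kronecker (m := (Fin B → y) × m) A hα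
  have isHermitian_swap : (swap (tensorPow B β ⊗ₖ
      deviation (Fin A) 1 α (margXM ρ))).IsHermitian := tensor_β.isHermitian isHermitian_X
  have traceNorm_X := tensor_β.traceNorm_le isHermitian_X
  have traceNorm_Y := tensor_α.traceNorm_le isHermitian_Y
  rw [one_mul] at traceNorm_X traceNorm_Y
  rw [convexSplitState_sub_decoupledState]
  refine (traceNorm_add_le (isHermitian_cross.add isHermitian_swap)
    (tensor_α.isHermitian isHermitian_Y)).trans (add_le_add ?_ traceNorm_Y)
  exact (traceNorm_add_le isHermitian_cross isHermitian_swap).trans (add_le_add le_rfl traceNorm_X)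

end MarginalTerms

end ConvexSplit

theorem mainTheorem3_general {x y m : Type*} [Fintype x] [DecidableEq x] [Fintype y]
    [DecidableEq y] [Fintype m] [DecidableEq m] {A B : ℕ} (hA : 0 < A) (hB : 0 < B)
    {ε : ℝ} (hε : 0 < ε) {ρ : Matrix (x × y × m) (x × y × m) ℂ} (hρ : ρ.IsHermitian)
    (htrace : 0 < ρ.trace.re) {α : Matrix x x ℂ} (hα : ConvexSplit.IsDensity α)
    {β : Matrix y y ℂ} (hβ : ConvexSplit.IsDensity β) {θ : Matrix m m ℂ} (hθ : θ.PosSemidef)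
    (hθρ : θ.trace.re ≤ ρ.trace.re)
    (h1 : ConvexSplit.smoothD2 ε (ConvexSplit.margXM ρ) (α ⊗ₖ θ)
        - ((Real.logb 2 ρ.trace.re : ℝ) : EReal) + ((Real.logb 2 (ε ^ (-2 : ℤ)) : ℝ) : EReal) <
      ((Real.logb 2 A : ℝ) : EReal))
    (h2 : ConvexSplit.smoothD2 ε (ConvexSplit.margYM ρ) (β ⊗ₖ θ)
        - ((Real.logb 2 ρ.trace.re : ℝ) : EReal) + ((Real.logb 2 (ε ^ (-2 : ℤ)) : ℝ) : EReal) <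
      ((Real.logb 2 B : ℝ) : EReal))
    (h3 : ConvexSplit.smoothD2 ε ρ (α ⊗ₖ (β ⊗ₖ θ))
        - ((Real.logb 2 ρ.trace.re : ℝ) : EReal) + ((Real.logb 2 (ε ^ (-2 : ℤ)) : ℝ) : EReal) <
      ((Real.logb 2 A + Real.logb 2 B : ℝ) : EReal)) :
    ConvexSplit.traceNorm
        (ConvexSplit.convexSplitState A B ρ α β - ConvexSplit.decoupledState A B ρ α β)
      ≤ 11 * (ε * ρ.trace.re) := by
  have : NeZero A := ⟨hA.ne'⟩
  have : NeZero B := ⟨hB.ne'⟩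
  have cross_le := ConvexSplit.traceNorm_deviation_onSecond_deviation_le_of_smoothD2_lt
    (ι := Fin A) (κ := Fin B) hα hβ hρ htrace hθ hθρ hε (by
      rwa [Fintype.card_fin, Fintype.card_fin, Real.logb_mul (Nat.cast_ne_zero.mpr hA.ne')
        (Nat.cast_ne_zero.mpr hB.ne')])
  have margXM_le := ConvexSplit.traceNorm_deviation_le_of_smoothD2_lt (Fin A) hα
    (ConvexSplit.isHermitian_margXM hρ) htrace (congrArg Complex.re (ConvexSplit.trace_margXM ρ))
    hθ hθρ hε (by rwa [Fintype.card_fin])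
  have margYM_le := ConvexSplit.traceNorm_deviation_le_of_smoothD2_lt (Fin B) hβ
    (ConvexSplit.isHermitian_margYM hρ) htrace (congrArg Complex.re (ConvexSplit.trace_margYM ρ))
    hθ hθρ hε (by rwa [Fintype.card_fin])
  linarith [ConvexSplit.traceNorm_convexSplitState_sub_decoupledState_le (A := A) (B := B)
    hα hβ hρ]

theorem mainTheorem3 {x y m : Type*} [Fintype x] [DecidableEq x] [Fintype y] [DecidableEq y]
    [Fintype m] [DecidableEq m] (A B : ℕ) (hA : 0 < A) (hB : 0 < B)
    (ε : ℝ) (hε0 : 0 < ε) (hε1 : ε < 1)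
    (ρ : Matrix (x × y × m) (x × y × m) ℂ) (hρ : ConvexSplit.IsSubnormalised ρ) (hρ0 : ρ ≠ 0)
    (α : Matrix x x ℂ) (hα : ConvexSplit.IsDensity α)
    (β : Matrix y y ℂ) (hβ : ConvexSplit.IsDensity β)
    (hsα : ConvexSplit.supp (ConvexSplit.margX ρ) ≤ ConvexSplit.supp α)
    (hsβ : ConvexSplit.supp (ConvexSplit.margY ρ) ≤ ConvexSplit.supp β)
    (h1 : ((Real.logb 2 A : ℝ) : EReal) >
      ConvexSplit.smoothD2 ε (ConvexSplit.margXM ρ) (α ⊗ₖ ConvexSplit.margM ρ)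
        - ((Real.logb 2 ρ.trace.re : ℝ) : EReal) + ((Real.logb 2 (ε ^ (-2 : ℤ)) : ℝ) : EReal))
    (h2 : ((Real.logb 2 B : ℝ) : EReal) >
      ConvexSplit.smoothD2 ε (ConvexSplit.margYM ρ) (β ⊗ₖ ConvexSplit.margM ρ)
        - ((Real.logb 2 ρ.trace.re : ℝ) : EReal) + ((Real.logb 2 (ε ^ (-2 : ℤ)) : ℝ) : EReal))
    (h3 : ((Real.logb 2 A + Real.logb 2 B : ℝ) : EReal) >
      ConvexSplit.smoothD2 ε ρ (α ⊗ₖ (β ⊗ₖ ConvexSplit.margM ρ))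
        - ((Real.logb 2 ρ.trace.re : ℝ) : EReal) + ((Real.logb 2 (ε ^ (-2 : ℤ)) : ℝ) : EReal)) :
    ConvexSplit.traceNorm
        (ConvexSplit.convexSplitState A B ρ α β - ConvexSplit.decoupledState A B ρ α β)
      < 16 * ε * ρ.trace.re := by
  have htrace : 0 < ρ.trace.re := (Complex.pos_iff.mp
    (hρ.1.trace_nonneg.lt_of_ne' (mt hρ.1.trace_eq_zero_iff.mp hρ0))).1
  refine (mainTheorem3_general hA hB hε0 hρ.1.1 htrace hα hβ
    (ConvexSplit.posSemidef_margM hρ.1) (ConvexSplit.trace_margM ρ ▸ le_rfl) h1 h2 h3).trans_lt ?_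
  linarith [mul_pos hε0 htrace]
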